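/- Let $A=\{0,1\}$, and let $A^*$ be the set of all finite words over $A$, including the empty word. A partial function $f\colon A^*\to A^*$ is called *polynomially balanced* if there are polynomials $p,q$ such that $|f(x)|\le p(|x|)$ and $|x|\le q(|f(x)|)$ for all $x\in\mathrm{Dom}(f)$. It is called *polynomial-time computable* if a deterministic polynomial-time Turing machine, on every input $x\in A^*$, outputs $f(x)$ when $x\in\mathrm{Dom}(f)$, and halts without output when $x\notin\mathrm{Dom}(f)$. It is called a *right-ideal morphism* if for all $x\in\mathrm{Dom}(f)$ and all $w\in A^*$ we have $xw\in\mathrm{Dom}(f)$ and $f(xw)=f(x)\,w$. Let $\mathcal{RM}_2^{\mathsf P}$ be the set of all polynomially balanced, polynomial-time computable right-ideal morphisms $A^*\to A^*$. **Theorem.** $\mathcal{RM}_2^{\mathsf P}$ is a monoid under composition of partial functions, and this monoid is not finitely generated. -/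

import Mathlib

/-- Partial functions `{0,1}* → {0,1}*`. Words are lists of Booleans (`false` is the letter `0`,
`true` is the letter `1`), and `f x = none` means that `f x` is undefined. -/
def PartialWordFun : Type := List Bool → Option (List Bool)

namespace PartialWordFun

/-- The monoid of all partial functions under composition: `(f * g) x = f (g x)`, and the neutral
element is the identity function. -/
instance : Monoid PartialWordFun where
  mul f g := fun x => (g x).bind f
  one := fun x => some x
  mul_assoc f g h := by
    funext x
    change (h x).bind (fun y => (g y).bind f) = ((h x).bind g).bind f
    cases h x <;> rfl
  one_mul f := by
    funext x
    change (f x).bind some = f x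
    cases f x <;> rfl
  mul_one f := rfl

/-- The final content of the output tape of a machine with partial input-output function: the first
letter `true` says that the machine halted with an output, which is the remaining word; a blank
tape says that the machine halted without output. -/
def encodeOutput : Option (List Bool) → List Bool
  | none => []
  | some y => true :: y

/-- `f` is computed by a deterministic polynomial-time Turing machine, which halts on every input,
and which produces an output exactly on the inputs in the domain of `f`. -/
def IsPolyTime (f : PartialWordFun) : Prop :=
  Nonempty (Turing.TM2ComputableInPolyTime (fun x : List Bool => x) encodeOutput f)

/-- Polynomial input-output balance. -/
def IsPolyBalanced (f : PartialWordFun) : Prop :=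
  ∃ p q : Polynomial ℕ, ∀ x y : List Bool, f x = some y →
    y.length ≤ p.eval x.length ∧ x.length ≤ q.eval y.length

/-- Right-ideal morphisms: if `f x` is defined then `f (x w)` is defined and equal to `(f x) w`,
for every word `w`. In particular the domain of `f` is a right ideal. -/
def IsRightIdealMorphism (f : PartialWordFun) : Prop :=
  ∀ x y : List Bool, f x = some y → ∀ w : List Bool, f (x ++ w) = some (y ++ w)

/-- The set `fP` of the polynomially balanced, polynomial-time computable partial functions. -/
def fP : Set PartialWordFun := {f | f.IsPolyBalanced ∧ f.IsPolyTime}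

/-- The set `RM₂ᴾ` of the right-ideal morphisms in `fP`. -/
def RM2P : Set PartialWordFun := {f | f ∈ fP ∧ f.IsRightIdealMorphism}

end PartialWordFun

/-!
Closure under composition needs a machine that runs two given polynomial-time stack machines one
after the other. Machines are therefore built from `Turing.Routine`s, program fragments that can be
composed, branched, iterated, and run as subroutines on disjoint stacks; `IsPolyTime.mul` is the
composition.

For the second part, let `g 0, g 1, …` be finitely many right-ideal morphisms. The function
`diag g` is the identity restricted to a right ideal, so it is a balanced right-ideal morphism for
free. For every word over the generators, with code word `b` in a prefix code, this right ideal
contains a shortest word of the form `b 0ⁿ`, and `n` is found by the following simulation of the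
product `h` of the generators. Start with `z = b`; for each generator `gⱼ` in turn, consume
`|z|` zeros of the input and compute `gⱼ (z 0^|z|)`. If this is undefined, accept at once; otherwise
it is the new `z`. When all generators have been applied, accept after one more zero. In the
first case `h` is undefined on the accepted word `b 0ⁿ`, because the generators are right-ideal
morphisms; in the second case `h` is already defined on `b 0ⁿ⁻¹`, which is not accepted. Either way
`h ≠ diag g` (`exists_accepts`, `diag_notMem_closure`).

The simulation takes polynomial time with a degree that does not depend on the word over the
generators, although the products themselves have unbounded degrees: a generator is only applied to
words of length at most twice the length of the input, since otherwise the zeros of the input do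
not suffice and the input is rejected (`Prog.does_applyLetter`, `diag_isPolyTime`).
-/

/-! ### Structured programs for stack machines -/

namespace Turing

open TM2 TM2.Stmt Function

/-- A program fragment for a stack machine with stacks of alphabets `Γ`. It starts at the label
`main` in the internal state `start`, and by convention (see `Routine.Runs`) it is finished when it
halts in the internal state `start`, so that it can be run again. -/
structure Routine {K : Type} (Γ : K → Type) : Type 1 where
  Λ : Type
  σ : Type
  [finΛ : Fintype Λ]
  [finσ : Fintype σ]
  main : Λ
  start : σ
  prog : Λ → TM2.Stmt Γ Λ σ

/-- `StepsTo f n a b`: the transition function `f` leads from `a` to `b` in exactly `n` steps. -/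
def StepsTo {α : Type*} (f : α → Option α) (n : ℕ) (a b : α) : Prop :=
  (flip bind f)^[n] (some a) = some b

theorem stepsTo_zero {α : Type*} {f : α → Option α} {a b : α} : StepsTo f 0 a b ↔ a = b := by
  simp [StepsTo]

theorem iterate_bind_none {α : Type*} (f : α → Option α) (n : ℕ) :
    (flip bind f)^[n] none = none := by
  induction n with
  | zero => rfl
  | succ n ih => rw [iterate_succ_apply]; exact ih

theorem stepsTo_succ {α : Type*} {f : α → Option α} {n : ℕ} {a b : α} :
    StepsTo f (n + 1) a b ↔ ∃ c, f a = some c ∧ StepsTo f n c b := by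
  unfold StepsTo
  rw [iterate_succ_apply]
  change (flip bind f)^[n] (f a) = _ ↔ _
  cases f a with
  | none => rw [iterate_bind_none]; simp
  | some c => simp

theorem StepsTo.trans {α : Type*} {f : α → Option α} {m n : ℕ} {a b c : α}
    (h₁ : StepsTo f m a b) (h₂ : StepsTo f n b c) : StepsTo f (m + n) a c := by
  unfold StepsTo at *
  rw [add_comm, iterate_add_apply, h₁, h₂]

section Embedding

variable {K₁ K : Type} [DecidableEq K₁] [DecidableEq K] {Γ : K → Type}
  {Λ₁ Λ σ₁ σ : Type}

/-- Translation of a statement of one machine into a statement of a larger machine: stacks are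
renamed by `e` and labels by `lab`, the internal state of the small machine is the component of
that of the large one given by `get` and `set`, and halting becomes a jump to `exit`, or halting if
`exit` is `none`. -/
def embedStmt (e : K₁ → K) (lab : Λ₁ → Λ) (get : σ → σ₁) (set : σ₁ → σ → σ) (exit : Option Λ) :
    TM2.Stmt (fun k => Γ (e k)) Λ₁ σ₁ → TM2.Stmt Γ Λ σ
  | push k f q => push (e k) (fun s => f (get s)) (embedStmt e lab get set exit q)
  | peek k f q => peek (e k) (fun s h => set (f (get s) h) s) (embedStmt e lab get set exit q)
  | pop k f q => pop (e k) (fun s h => set (f (get s) h) s) (embedStmt e lab get set exit q)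
  | load f q => load (fun s => set (f (get s)) s) (embedStmt e lab get set exit q)
  | branch p q₁ q₂ => branch (fun s => p (get s)) (embedStmt e lab get set exit q₁)
      (embedStmt e lab get set exit q₂)
  | goto f => goto (fun s => lab (f (get s)))
  | halt => match exit with
    | some l => goto (fun _ => l)
    | none => halt

variable {e : K₁ → K} {lab : Λ₁ → Λ} {get : σ → σ₁} {set : σ₁ → σ → σ} {exit : Option Λ}

theorem stepAux_embedStmt (he : Injective e) (get_set : ∀ v s, get (set v s) = v)
    (set_set : ∀ v v' s, set v (set v' s) = set v s) (set_get : ∀ s, set (get s) s = s)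
    (q : TM2.Stmt (fun k => Γ (e k)) Λ₁ σ₁) (s : σ) (S : ∀ k, List (Γ k)) :
    ∃ S', stepAux (embedStmt e lab get set exit q) s S =
        ⟨(stepAux q (get s) (fun k => S (e k))).l.elim exit (fun l => some (lab l)),
          set (stepAux q (get s) (fun k => S (e k))).var s, S'⟩ ∧
      (fun k => S' (e k)) = (stepAux q (get s) (fun k => S (e k))).stk ∧
      ∀ k, k ∉ Set.range e → S' k = S k := by
  induction q generalizing s S with
  | push k f q ih =>
    obtain ⟨S', h1, h2, h3⟩ := ih s (update S (e k) (f (get s) :: S (e k)))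
    rw [update_comp_eq_of_injective' S he] at h1 h2
    refine ⟨S', h1, h2, fun k' hk' => ?_⟩
    rw [h3 k' hk', update_of_ne]
    rintro rfl
    exact hk' ⟨k, rfl⟩
  | peek k f q ih =>
    obtain ⟨S', h1, h2, h3⟩ := ih (set (f (get s) (S (e k)).head?) s) S
    rw [get_set] at h1 h2
    rw [set_set] at h1
    exact ⟨S', h1, h2, h3⟩
  | pop k f q ih =>
    obtain ⟨S', h1, h2, h3⟩ := ih (set (f (get s) (S (e k)).head?) s)
      (update S (e k) (S (e k)).tail)
    rw [get_set] at h1 h2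
    rw [set_set] at h1
    rw [update_comp_eq_of_injective' S he] at h1 h2
    refine ⟨S', h1, h2, fun k' hk' => ?_⟩
    rw [h3 k' hk', update_of_ne]
    rintro rfl
    exact hk' ⟨k, rfl⟩
  | load f q ih =>
    obtain ⟨S', h1, h2, h3⟩ := ih (set (f (get s)) s) S
    rw [get_set] at h1 h2
    rw [set_set] at h1
    exact ⟨S', h1, h2, h3⟩
  | branch p q₁ q₂ ih₁ ih₂ =>
    cases hp : p (get s)
    · simpa [embedStmt, hp] using ih₂ s S
    · simpa [embedStmt, hp] using ih₁ s S
  | goto f => exact ⟨S, by simp [embedStmt, set_get], rfl, fun _ _ => rfl⟩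
  | halt =>
    refine ⟨S, ?_, rfl, fun _ _ => rfl⟩
    cases exit <;> simp [embedStmt, set_get]

/-- A halting run of the small machine is a run of the large machine from the corresponding
configuration to the label `exit`, in the same number of steps. -/
theorem stepsTo_embed (he : Injective e) (get_set : ∀ v s, get (set v s) = v)
    (set_set : ∀ v v' s, set v (set v' s) = set v s) (set_get : ∀ s, set (get s) s = s)
    {m₁ : Λ₁ → TM2.Stmt (fun k => Γ (e k)) Λ₁ σ₁} {m : Λ → TM2.Stmt Γ Λ σ}
    (hm : ∀ l, m (lab l) = embedStmt e lab get set exit (m₁ l)) {n : ℕ} {l : Λ₁} {s : σ} {v : σ₁}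
    {S : ∀ k, List (Γ k)} {T : ∀ k, List (Γ (e k))}
    (h : StepsTo (TM2.step m₁) n ⟨some l, get s, fun k => S (e k)⟩ ⟨none, v, T⟩) :
    ∃ S', StepsTo (TM2.step m) n ⟨some (lab l), s, S⟩ ⟨exit, set v s, S'⟩ ∧
      (fun k => S' (e k)) = T ∧ ∀ k, k ∉ Set.range e → S' k = S k := by
  induction n generalizing l s S with
  | zero => simp [stepsTo_zero] at h
  | succ n ih =>
    obtain ⟨c, hc, h⟩ := stepsTo_succ.1 h
    obtain ⟨S', h1, h2, h3⟩ := stepAux_embedStmt (lab := lab) (exit := exit) he get_set set_set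
      set_get (m₁ l) s S
    obtain rfl : stepAux (m₁ l) (get s) (fun k => S (e k)) = c := by simpa using hc
    generalize stepAux (m₁ l) (get s) (fun k => S (e k)) = c at *
    obtain ⟨l', v', T'⟩ := c
    simp only at h1 h2
    subst h2
    have hstep : TM2.step m ⟨some (lab l), s, S⟩ = some ⟨l'.elim exit (fun l => some (lab l)),
        set v' s, S'⟩ := by simp [hm, h1]
    cases l' with
    | none =>
      have hn : n = 0 := by
        cases n with
        | zero => rfl
        | succ n =>
          obtain ⟨c, hc, _⟩ := stepsTo_succ.1 h
          simp at hc
      subst hn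
      simp only [stepsTo_zero, Cfg.mk.injEq, true_and] at h
      obtain ⟨rfl, rfl⟩ := h
      exact ⟨S', stepsTo_succ.2 ⟨_, hstep, stepsTo_zero.2 rfl⟩, rfl, h3⟩
    | some l' =>
      rw [← get_set v' s] at h
      obtain ⟨S'', g1, g2, g3⟩ := ih h
      rw [set_set] at g1
      exact ⟨S'', stepsTo_succ.2 ⟨_, hstep, g1⟩, g2, fun k hk => (g3 k hk).trans (h3 k hk)⟩

theorem stepsTo_embed_id {lab : Λ₁ → Λ} {get : σ → σ₁} {set : σ₁ → σ → σ} {exit : Option Λ}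
    (get_set : ∀ v s, get (set v s) = v)
    (set_set : ∀ v v' s, set v (set v' s) = set v s) (set_get : ∀ s, set (get s) s = s)
    {m₁ : Λ₁ → TM2.Stmt Γ Λ₁ σ₁} {m : Λ → TM2.Stmt Γ Λ σ}
    (hm : ∀ l, m (lab l) = embedStmt (fun k => k) lab get set exit (m₁ l)) {n : ℕ} {l : Λ₁} {s : σ}
    {S T : ∀ k, List (Γ k)}
    (h : StepsTo (TM2.step m₁) n ⟨some l, get s, S⟩ ⟨none, get s, T⟩) :
    StepsTo (TM2.step m) n ⟨some (lab l), s, S⟩ ⟨exit, s, T⟩ := by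
  obtain ⟨S', h1, h2, -⟩ := stepsTo_embed (e := fun k => k) (fun _ _ h => h) get_set set_set
    set_get hm h
  rw [set_get] at h1
  cases h2
  exact h1

end Embedding

namespace Routine

variable {K : Type} [DecidableEq K] {Γ : K → Type}

attribute [instance] Routine.finΛ Routine.finσ

/-- Started with stacks `S`, the routine halts after at most `t` steps with stacks `S'`. -/
def Runs (P : Routine Γ) (S S' : ∀ k, List (Γ k)) (t : ℕ) : Prop :=
  ∃ n ≤ t, StepsTo (TM2.step P.prog) n ⟨some P.main, P.start, S⟩ ⟨none, P.start, S'⟩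

theorem Runs.mono {P : Routine Γ} {S S' : ∀ k, List (Γ k)} {t t' : ℕ} (h : P.Runs S S' t)
    (ht : t ≤ t') : P.Runs S S' t' :=
  let ⟨n, hn, h⟩ := h
  ⟨n, hn.trans ht, h⟩

theorem Runs.congr {P : Routine Γ} {S S' T T' : ∀ k, List (Γ k)} {t : ℕ} (h : P.Runs S S' t)
    (hS : S = T) (hS' : S' = T') : P.Runs T T' t :=
  hS ▸ hS' ▸ h

/-- Does nothing. -/
def skip : Routine Γ where
  Λ := Unit
  σ := Unit
  main := ()
  start := ()
  prog _ := halt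

theorem runs_skip (S : ∀ k, List (Γ k)) : skip.Runs S S 1 :=
  ⟨1, le_rfl, rfl⟩

/-- Pushes `a` on the stack `k`. -/
def push (k : K) (a : Γ k) : Routine Γ where
  Λ := Unit
  σ := Unit
  main := ()
  start := ()
  prog _ := Stmt.push k (fun _ => a) halt

theorem runs_push (k : K) (a : Γ k) (S : ∀ k, List (Γ k)) :
    (push k a).Runs S (update S k (a :: S k)) 1 :=
  ⟨1, le_rfl, rfl⟩

/-- Pops the stack `k`; an empty stack stays empty. -/
def pop (k : K) : Routine Γ where
  Λ := Unit
  σ := Unit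
  main := ()
  start := ()
  prog _ := Stmt.pop k (fun _ _ => ()) halt

theorem runs_pop (k : K) (S : ∀ k, List (Γ k)) :
    (pop k).Runs S (update S k (S k).tail) 1 :=
  ⟨1, le_rfl, rfl⟩

/-- `P` followed by `Q`. -/
def seq (P Q : Routine Γ) : Routine Γ where
  Λ := P.Λ ⊕ Q.Λ
  σ := P.σ × Q.σ
  main := Sum.inl P.main
  start := (P.start, Q.start)
  prog
    | .inl l => embedStmt (fun k => k) Sum.inl Prod.fst (fun v s => (v, s.2))
        (some (Sum.inr Q.main)) (P.prog l)
    | .inr l => embedStmt (fun k => k) Sum.inr Prod.snd (fun v s => (s.1, v)) none (Q.prog l)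

theorem Runs.seq {P Q : Routine Γ} {S S' S'' : ∀ k, List (Γ k)} {t t' : ℕ} (h : P.Runs S S' t)
    (h' : Q.Runs S' S'' t') : (P.seq Q).Runs S S'' (t + t') := by
  obtain ⟨n, hn, h⟩ := h
  obtain ⟨n', hn', h'⟩ := h'
  refine ⟨n + n', by omega, StepsTo.trans (b := ⟨some (Sum.inr Q.main), (P.start, Q.start), S'⟩)
    ?_ ?_⟩
  · exact stepsTo_embed_id (m := (P.seq Q).prog) (lab := Sum.inl)
      (s := (P.start, Q.start)) (get := Prod.fst) (set := fun v s => (v, s.2)) (fun _ _ => rfl)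
      (fun _ _ _ => rfl) (fun _ => rfl) (fun _ => rfl) h
  · exact stepsTo_embed_id (m := (P.seq Q).prog) (lab := Sum.inr)
      (s := (P.start, Q.start)) (get := Prod.snd) (set := fun v s => (s.1, v)) (fun _ _ => rfl)
      (fun _ _ _ => rfl) (fun _ => rfl) (fun _ => rfl) h'

/-- Tests the top of the stack `k`, which is `none` if the stack is empty, and runs `P` or `Q`.
The Boolean in the internal state stores the outcome of the test, and is reset at once. -/
def ite (k : K) (p : Option (Γ k) → Bool) (P Q : Routine Γ) : Routine Γ where
  Λ := Option (P.Λ ⊕ Q.Λ)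
  σ := Bool × P.σ × Q.σ
  main := none
  start := (false, P.start, Q.start)
  prog
    | none => Stmt.peek k (fun s h => (p h, s.2)) (Stmt.branch Prod.fst
        (Stmt.load (fun s => (false, s.2)) (goto fun _ => some (Sum.inl P.main)))
        (Stmt.load (fun s => (false, s.2)) (goto fun _ => some (Sum.inr Q.main))))
    | some (.inl l) => embedStmt (fun k => k) (fun l => some (Sum.inl l)) (fun s => s.2.1)
        (fun v s => (s.1, v, s.2.2)) none (P.prog l)
    | some (.inr l) => embedStmt (fun k => k) (fun l => some (Sum.inr l)) (fun s => s.2.2)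
        (fun v s => (s.1, s.2.1, v)) none (Q.prog l)

theorem Runs.ite_true {k : K} {p : Option (Γ k) → Bool} {P Q : Routine Γ}
    {S S' : ∀ k, List (Γ k)} {t : ℕ} (hp : p (S k).head? = true) (h : P.Runs S S' t) :
    (ite k p P Q).Runs S S' (t + 1) := by
  obtain ⟨n, hn, h⟩ := h
  refine ⟨n + 1, by omega, stepsTo_succ.2
    ⟨⟨some (some (Sum.inl P.main)), (false, P.start, Q.start), S⟩, by simp [ite, hp], ?_⟩⟩
  exact stepsTo_embed_id (get := fun s => s.2.1) (set := fun v s => (s.1, v, s.2.2))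
    (lab := fun l => some (Sum.inl l)) (fun _ _ => rfl)
    (fun _ _ _ => rfl) (fun _ => rfl) (fun _ => rfl) h

theorem Runs.ite_false {k : K} {p : Option (Γ k) → Bool} {P Q : Routine Γ}
    {S S' : ∀ k, List (Γ k)} {t : ℕ} (hp : p (S k).head? = false) (h : Q.Runs S S' t) :
    (ite k p P Q).Runs S S' (t + 1) := by
  obtain ⟨n, hn, h⟩ := h
  refine ⟨n + 1, by omega, stepsTo_succ.2
    ⟨⟨some (some (Sum.inr Q.main)), (false, P.start, Q.start), S⟩, by simp [ite, hp], ?_⟩⟩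
  exact stepsTo_embed_id (get := fun s => s.2.2) (set := fun v s => (s.1, s.2.1, v))
    (lab := fun l => some (Sum.inr l)) (fun _ _ => rfl)
    (fun _ _ _ => rfl) (fun _ => rfl) (fun _ => rfl) h

/-- Runs `P` as long as the top of the stack `k` satisfies `p`. -/
def loop (k : K) (p : Option (Γ k) → Bool) (P : Routine Γ) : Routine Γ where
  Λ := Option P.Λ
  σ := Bool × P.σ
  main := none
  start := (false, P.start)
  prog
    | none => Stmt.peek k (fun s h => (p h, s.2)) (Stmt.branch Prod.fst
        (Stmt.load (fun s => (false, s.2)) (goto fun _ => some P.main))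
        (Stmt.load (fun s => (false, s.2)) halt))
    | some l => embedStmt (fun k => k) some Prod.snd (fun v s => (s.1, v)) (some none) (P.prog l)

theorem Runs.loop_done {k : K} {p : Option (Γ k) → Bool} {P : Routine Γ}
    {S : ∀ k, List (Γ k)} (hp : p (S k).head? = false) : (loop k p P).Runs S S 1 :=
  ⟨1, le_rfl, stepsTo_succ.2 ⟨_, by simp [loop, hp], stepsTo_zero.2 rfl⟩⟩

theorem Runs.loop_step {k : K} {p : Option (Γ k) → Bool} {P : Routine Γ}
    {S S' S'' : ∀ k, List (Γ k)} {t t' : ℕ} (hp : p (S k).head? = true) (h : P.Runs S S' t)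
    (h' : (loop k p P).Runs S' S'' t') : (loop k p P).Runs S S'' (t + t' + 1) := by
  obtain ⟨n, hn, h⟩ := h
  obtain ⟨n', hn', h'⟩ := h'
  refine ⟨n + n' + 1, by omega, stepsTo_succ.2
    ⟨⟨some (some P.main), (false, P.start), S⟩, by simp [loop, hp],
      StepsTo.trans (b := ⟨some none, (false, P.start), S'⟩) ?_ h'⟩⟩
  exact stepsTo_embed_id (m := (loop k p P).prog) (lab := some) (s := (false, P.start))
    (get := Prod.snd) (set := fun v s => (s.1, v)) (fun _ _ => rfl)
    (fun _ _ _ => rfl) (fun _ => rfl) (fun _ => rfl) h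

/-- A routine on some of the stacks, as a routine on all stacks. -/
def lift {K₁ : Type} (e : K₁ → K) (P : Routine (fun k => Γ (e k))) : Routine Γ where
  Λ := P.Λ
  σ := P.σ
  main := P.main
  start := P.start
  prog l := embedStmt e id id (fun v _ => v) none (P.prog l)

theorem Runs.lift {K₁ : Type} [DecidableEq K₁] {e : K₁ → K} (he : Injective e)
    {P : Routine (fun k => Γ (e k))} {S S' : ∀ k, List (Γ k)} {t : ℕ}
    (h : P.Runs (fun k => S (e k)) (fun k => S' (e k)) t)
    (hS : ∀ k, k ∉ Set.range e → S' k = S k) : (P.lift e).Runs S S' t := by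
  obtain ⟨n, hn, h⟩ := h
  obtain ⟨T, h1, h2, h3⟩ := stepsTo_embed (m := (P.lift e).prog) (lab := id) (get := id)
    (set := fun v _ => v) (s := P.start) (exit := none) he (fun _ _ => rfl)
    (fun _ _ _ => rfl) (fun _ => rfl) (fun _ => rfl) h
  have : T = S' := by
    funext k
    by_cases hk : k ∈ Set.range e
    · obtain ⟨k, rfl⟩ := hk
      exact congrFun h2 k
    · rw [h3 k hk, hS k hk]
  subst this
  exact ⟨n, hn, h1⟩

/-- Empties the stack `a` onto the stack `b`, translating the letters; this reverses the order. -/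
def transfer (a b : K) (p : Γ a ≃ Bool) (q : Bool → Γ b) : Routine Γ :=
  loop a Option.isSome
    (ite a (fun h => h.any p) ((pop a).seq (push b (q true))) ((pop a).seq (push b (q false))))

theorem runs_transfer {a b : K} (hab : a ≠ b) (p : Γ a ≃ Bool) (q : Bool → Γ b)
    (S : ∀ k, List (Γ k)) :
    (transfer a b p q).Runs S
      (update (update S a []) b (((S a).map fun x => q (p x)).reverse ++ S b))
      (4 * (S a).length + 1) := by
  generalize hl : S a = l
  induction l generalizing S with
  | nil =>
    have : update (update S a []) b (([].map fun x => q (p x)).reverse ++ S b) = S := by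
      have h : update S a [] = S := by rw [← hl, update_eq_self]
      simp [h]
    rw [this]
    exact Runs.loop_done (by simp [hl])
  | cons x l ih =>
    have key : (ite a (fun h => h.any p) ((pop a).seq (push b (q true)))
        ((pop a).seq (push b (q false)))).Runs S
        (update (update S a l) b (q (p x) :: S b)) 3 := by
      have h : ∀ c, ((pop a).seq (push b (q c))).Runs S (update (update S a l) b (q c :: S b))
          2 := by
        intro c
        have h1 := runs_pop a S
        have h2 := runs_push b (q c) (update S a l)
        rw [hl] at h1
        rw [update_of_ne hab.symm] at h2
        exact h1.seq h2
      cases hx : p x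
      · exact Runs.ite_false (by simp [hl, hx]) (h false)
      · exact Runs.ite_true (by simp [hl, hx]) (h true)
    have h2 := ih (update (update S a l) b (q (p x) :: S b)) (by simp [update_of_ne hab])
    have h3 := Runs.loop_step (p := Option.isSome) (by simp [hl]) key h2
    have : update (update (update (update S a l) b (q (p x) :: S b)) a []) b
          ((l.map fun x => q (p x)).reverse ++ update (update S a l) b (q (p x) :: S b) b) =
        update (update S a []) b (((x :: l).map fun x => q (p x)).reverse ++ S b) := by
      rw [update_comm hab, update_idem, update_comm hab, update_idem]
      simpa using update_comm hab.symm _ _ S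
    rw [this] at h3
    exact h3.mono (by simp; omega)

section Call

variable {K₁ : Type} [DecidableEq K₁] {e : K₁ → K}

theorem Runs.lift_update (he : Injective e) {P : Routine (fun k => Γ (e k))} {k₀ k₁ : K₁}
    {s : List (Γ (e k₀))} {s' : List (Γ (e k₁))} {t : ℕ} {S : ∀ k, List (Γ k)}
    (h : P.Runs (update (fun _ => []) k₀ s) (update (fun _ => []) k₁ s') t)
    (hS : ∀ k, S (e k) = []) :
    (P.lift e).Runs (update S (e k₀) s) (update S (e k₁) s') t := by
  refine Runs.lift he ?_ ?_
  · rw [update_comp_eq_of_injective' S he, update_comp_eq_of_injective' S he]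
    simpa only [hS] using h
  · intro k hk
    rw [update_of_ne (fun h => hk ⟨_, h.symm⟩), update_of_ne (fun h => hk ⟨_, h.symm⟩)]

/-- Subroutine call: transfers the word on the stack `a`, stored in reverse, to the input stack
`e k₀` of `P`, runs `P`, and reads its output stack `e k₁` as an encoded partial result. If it is
empty, then `c` is pushed on the stack `f`; otherwise its first letter is dropped and the remaining
word is transferred to `a`, again in reverse. -/
def call (a f : K) (pa : Γ a ≃ Bool) (c : Γ f) (e : K₁ → K) (P : Routine (fun k => Γ (e k)))
    (k₀ k₁ : K₁) (p₀ : Γ (e k₀) ≃ Bool) (p₁ : Γ (e k₁) ≃ Bool) : Routine Γ :=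
  ((transfer a (e k₀) pa p₀.symm).seq (P.lift e)).seq
    (ite (e k₁) Option.isSome ((pop (e k₁)).seq (transfer (e k₁) a p₁ pa.symm)) (push f c))

variable {a f : K} {pa : Γ a ≃ Bool} {c : Γ f} {P : Routine (fun k => Γ (e k))}
    {k₀ k₁ : K₁} {p₀ : Γ (e k₀) ≃ Bool} {p₁ : Γ (e k₁) ≃ Bool} {S : ∀ k, List (Γ k)} {t : ℕ}
    {w : List Bool}

theorem runs_call_body (he : Injective e) (ha : a ∉ Set.range e) (hS : ∀ k, S (e k) = [])
    (hw : (S a).map pa = w) {s' : List (Γ (e k₁))}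
    (h : P.Runs (update (fun _ => []) k₀ (w.reverse.map p₀.symm)) (update (fun _ => []) k₁ s') t) :
    ((transfer a (e k₀) pa p₀.symm).seq (P.lift e)).Runs S (update (update S a []) (e k₁) s')
      (4 * w.length + 1 + t) := by
  have h1 := runs_transfer (fun h => ha ⟨_, h.symm⟩ : a ≠ e k₀) pa p₀.symm S
  have h2 : (((S a).map fun x => p₀.symm (pa x)).reverse ++ S (e k₀)) =
      w.reverse.map p₀.symm := by
    rw [hS, ← hw]
    simp
  rw [h2] at h1
  have h3 := Runs.lift_update (S := update S a []) he h (fun k => by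
    rw [update_of_ne (fun h => ha ⟨_, h⟩), hS])
  refine (h1.seq h3).mono ?_
  simp [← hw]

theorem runs_call_none (he : Injective e) (ha : a ∉ Set.range e)
    (haf : a ≠ f) (hS : ∀ k, S (e k) = []) (hw : (S a).map pa = w)
    (h : P.Runs (update (fun _ => []) k₀ (w.reverse.map p₀.symm)) (update (fun _ => []) k₁ []) t) :
    (call a f pa c e P k₀ k₁ p₀ p₁).Runs S (update (update S a []) f (c :: S f))
      (4 * w.length + t + 3) := by
  have h1 := runs_call_body he ha hS hw h
  have h2 : update (update S a []) (e k₁) [] = update S a [] := by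
    rw [update_eq_self_iff, update_of_ne (fun h => ha ⟨_, h⟩), hS]
  rw [h2] at h1
  have h3 := runs_push f c (update S a [])
  rw [update_of_ne haf.symm] at h3
  refine (h1.seq (Runs.ite_false ?_ h3)).mono (by omega)
  rw [update_of_ne (fun h => ha ⟨_, h⟩), hS]
  rfl

theorem runs_call_some (he : Injective e) (ha : a ∉ Set.range e) (hS : ∀ k, S (e k) = [])
    (hw : (S a).map pa = w) {b : Γ (e k₁)} {z : List Bool}
    (h : P.Runs (update (fun _ => []) k₀ (w.reverse.map p₀.symm))
      (update (fun _ => []) k₁ (b :: z.map p₁.symm)) t) :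
    (call a f pa c e P k₀ k₁ p₀ p₁).Runs S (update S a (z.reverse.map pa.symm))
      (4 * w.length + t + 4 * z.length + 4) := by
  have h1 := runs_call_body he ha hS hw h
  have h2 := runs_pop (e k₁) (update (update S a []) (e k₁) (b :: z.map p₁.symm))
  have hne : e k₁ ≠ a := fun h => ha ⟨_, h⟩
  rw [update_idem, update_self, List.tail_cons] at h2
  have h3 := runs_transfer hne p₁ pa.symm (update (update S a []) (e k₁) (z.map p₁.symm))
  have h4 : update (update (update (update S a []) (e k₁) (z.map p₁.symm)) (e k₁) []) a
      (((update (update S a []) (e k₁) (z.map p₁.symm) (e k₁)).map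
        fun x => pa.symm (p₁ x)).reverse ++ update (update S a []) (e k₁) (z.map p₁.symm) a) =
      update S a (z.reverse.map pa.symm) := by
    rw [update_idem, update_self, update_of_ne hne.symm, update_self]
    have : update (update S a []) (e k₁) [] = update S a [] := by
      rw [update_eq_self_iff, update_of_ne hne, hS]
    rw [this, update_idem]
    simp [Function.comp_def]
  rw [h4, update_self, List.length_map] at h3
  exact (h1.seq (Runs.ite_true (by simp) (h2.seq h3))).mono (by omega)

end Call

end Routine

end Turing

namespace PartialWordFun

open Turing Function

/-! ### Registers, programs on registers, and subroutine calls -/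

/-- The registers of the machines built below: stacks of Booleans. The register `input` holds the
input and, at the end, the output. -/
inductive Reg
  | input | aux | rest | code | word | tmp | index | flag
  deriving DecidableEq

open Reg

instance : Fintype Reg where
  elems := {input, aux, rest, code, word, tmp, index, flag}
  complete k := by cases k <;> simp

/-- The contents of the registers, in the order `input`, `aux`, `rest`, `code`, `word`, `tmp`,
`index`, `flag`. -/
def mem (x a v w r z j f : List Bool) : Reg → List Bool
  | input => x
  | aux => a
  | rest => v
  | code => w
  | word => r
  | tmp => z
  | index => j
  | flag => f

section mem

variable (x a v w r z j f l : List Bool)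

@[simp] theorem mem_input : mem x a v w r z j f input = x := rfl
@[simp] theorem mem_aux : mem x a v w r z j f aux = a := rfl
@[simp] theorem mem_rest : mem x a v w r z j f rest = v := rfl
@[simp] theorem mem_code : mem x a v w r z j f code = w := rfl
@[simp] theorem mem_word : mem x a v w r z j f word = r := rfl
@[simp] theorem mem_tmp : mem x a v w r z j f tmp = z := rfl
@[simp] theorem mem_index : mem x a v w r z j f index = j := rfl
@[simp] theorem mem_flag : mem x a v w r z j f flag = f := rfl

@[simp] theorem update_mem_input :
    update (mem x a v w r z j f) input l = mem l a v w r z j f := by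
  funext k; cases k <;> rfl
@[simp] theorem update_mem_aux : update (mem x a v w r z j f) aux l = mem x l v w r z j f := by
  funext k; cases k <;> rfl
@[simp] theorem update_mem_rest : update (mem x a v w r z j f) rest l = mem x a l w r z j f := by
  funext k; cases k <;> rfl
@[simp] theorem update_mem_code : update (mem x a v w r z j f) code l = mem x a v l r z j f := by
  funext k; cases k <;> rfl
@[simp] theorem update_mem_word : update (mem x a v w r z j f) word l = mem x a v w l z j f := by
  funext k; cases k <;> rfl
@[simp] theorem update_mem_tmp : update (mem x a v w r z j f) tmp l = mem x a v w r l j f := by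
  funext k; cases k <;> rfl
@[simp] theorem update_mem_index :
    update (mem x a v w r z j f) index l = mem x a v w r z l f := by
  funext k; cases k <;> rfl
@[simp] theorem update_mem_flag : update (mem x a v w r z j f) flag l = mem x a v w r z j l := by
  funext k; cases k <;> rfl

end mem

/-- A machine of Mathlib, as a routine on its own stacks. -/
def routineOf (tm : FinTM2) : Routine tm.Γ where
  Λ := tm.Λ
  σ := tm.σ
  finΛ := tm.ΛFin
  finσ := tm.σFin
  main := tm.main
  start := tm.initialState
  prog := tm.m

theorem initList_stk (tm : FinTM2) (s : List (tm.Γ tm.k₀)) :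
    (initList tm s).stk = update (fun _ => []) tm.k₀ s := by
  funext k
  by_cases h : k = tm.k₀
  · subst h
    simp [initList]
  · simp [initList, h]

theorem haltList_stk (tm : FinTM2) (s : List (tm.Γ tm.k₁)) :
    (haltList tm s).stk = update (fun _ => []) tm.k₁ s := by
  funext k
  by_cases h : k = tm.k₁
  · subst h
    simp [haltList]
  · simp [haltList, h]

theorem runs_routineOf {tm : FinTM2} {s : List (tm.Γ tm.k₀)} {s' : List (tm.Γ tm.k₁)} {t : ℕ}
    (h : TM2OutputsInTime tm s (some s') t) :
    (routineOf tm).Runs (update (fun _ => []) tm.k₀ s) (update (fun _ => []) tm.k₁ s') t := by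
  refine ⟨h.steps, h.steps_le_m, ?_⟩
  rw [← initList_stk, ← haltList_stk]
  exact h.evals_in_steps

section Registers

variable {ι : Type} (tm : ι → FinTM2)

/-- The stacks of a machine that has the given family of machines as subroutines: the registers,
and separate copies of the stacks of all the subroutines. -/
abbrev Stk : Type := Reg ⊕ (Σ i, (tm i).K)

/-- The alphabets of the stacks in `Stk`. -/
abbrev Alph : Stk tm → Type := Sum.elim (fun _ => Bool) (fun p => (tm p.1).Γ p.2)

/-- The contents of all stacks when the registers contain `M` and no subroutine is active. -/
def state (M : Reg → List Bool) : ∀ k, List (Alph tm k)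
  | .inl k => M k
  | .inr _ => []

variable [DecidableEq ι]

theorem update_state (M : Reg → List Bool) (k : Reg) (l : List Bool) :
    update (state tm M) (Sum.inl k) l = state tm (update M k l) := by
  funext k'
  rcases k' with k' | k'
  · by_cases h : k' = k
    · subst h
      exact (update_self (β := fun k => List (Alph tm k)) (Sum.inl k') l (state tm M)).trans
        (update_self k' l M).symm
    · exact (update_of_ne (β := fun k => List (Alph tm k)) (fun h' => h (Sum.inl.inj h')) l
        (state tm M)).trans (update_of_ne h l M : update M k l k' = M k').symm
  · exact update_of_ne (β := fun k => List (Alph tm k)) Sum.inr_ne_inl l (state tm M)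

variable {tm}

/-- Routines on the registers, with the machines `tm i` available as subroutines. -/
abbrev Prog (tm : ι → FinTM2) : Type 1 := Routine (Alph tm)

namespace Prog

/-- `P` transforms the register contents `M` into `M'` within `t` steps. -/
def Does (P : Prog tm) (M M' : Reg → List Bool) (t : ℕ) : Prop :=
  Routine.Runs P (state tm M) (state tm M') t

theorem Does.mono {P : Prog tm} {M M' : Reg → List Bool} {t t' : ℕ} (h : P.Does M M' t)
    (ht : t ≤ t') : P.Does M M' t' :=
  Routine.Runs.mono h ht

def skip : Prog tm := Routine.skip

theorem does_skip (M : Reg → List Bool) : (skip : Prog tm).Does M M 1 :=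
  Routine.runs_skip _

def push (k : Reg) (a : Bool) : Prog tm := Routine.push (Γ := Alph tm) (Sum.inl k) a

theorem does_push (k : Reg) (a : Bool) (M : Reg → List Bool) :
    (push k a : Prog tm).Does M (update M k (a :: M k)) 1 := by
  exact (Routine.runs_push (Γ := Alph tm) (Sum.inl k) a (state tm M)).congr rfl
    (update_state tm M k _)

def pop (k : Reg) : Prog tm := Routine.pop (Sum.inl k)

theorem does_pop (k : Reg) (M : Reg → List Bool) :
    (pop k : Prog tm).Does M (update M k (M k).tail) 1 := by
  exact (Routine.runs_pop (Γ := Alph tm) (Sum.inl k) (state tm M)).congr rfl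
    (update_state tm M k _)

def seq (P Q : Prog tm) : Prog tm := Routine.seq P Q

theorem Does.seq {P Q : Prog tm} {M M' M'' : Reg → List Bool} {t t' : ℕ} (h : P.Does M M' t)
    (h' : Q.Does M' M'' t') : (P.seq Q).Does M M'' (t + t') :=
  Routine.Runs.seq h h'

def ite (k : Reg) (p : Option Bool → Bool) (P Q : Prog tm) : Prog tm :=
  Routine.ite (Sum.inl k) p P Q

theorem Does.ite_true {k : Reg} {p : Option Bool → Bool} {P Q : Prog tm}
    {M M' : Reg → List Bool} {t : ℕ} (hp : p (M k).head? = true) (h : P.Does M M' t) :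
    (ite k p P Q).Does M M' (t + 1) :=
  Routine.Runs.ite_true hp h

theorem Does.ite_false {k : Reg} {p : Option Bool → Bool} {P Q : Prog tm}
    {M M' : Reg → List Bool} {t : ℕ} (hp : p (M k).head? = false) (h : Q.Does M M' t) :
    (ite k p P Q).Does M M' (t + 1) :=
  Routine.Runs.ite_false hp h

def loop (k : Reg) (p : Option Bool → Bool) (P : Prog tm) : Prog tm :=
  Routine.loop (Sum.inl k) p P

theorem Does.loop_done {k : Reg} {p : Option Bool → Bool} {P : Prog tm}
    {M : Reg → List Bool} (hp : p (M k).head? = false) : (loop k p P).Does M M 1 :=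
  Routine.Runs.loop_done hp

theorem Does.loop_step {k : Reg} {p : Option Bool → Bool} {P : Prog tm}
    {M M' M'' : Reg → List Bool} {t t' : ℕ} (hp : p (M k).head? = true) (h : P.Does M M' t)
    (h' : (loop k p P).Does M' M'' t') : (loop k p P).Does M M'' (t + t' + 1) :=
  Routine.Runs.loop_step hp h h'

/-- Empties the register `a` onto the register `b`. -/
def move (a b : Reg) : Prog tm :=
  Routine.transfer (Γ := Alph tm) (Sum.inl a) (Sum.inl b) (Equiv.refl Bool) id

theorem does_move {a b : Reg} (hab : a ≠ b) (M : Reg → List Bool) :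
    (move a b : Prog tm).Does M (update (update M a []) b ((M a).reverse ++ M b))
      (4 * (M a).length + 1) := by
  refine (Routine.runs_transfer (Γ := Alph tm) (a := Sum.inl a) (b := Sum.inl b)
    (fun h => hab (Sum.inl.inj h)) (Equiv.refl Bool) id (state tm M)).congr rfl ?_
  have hl : ((M a).map fun x => id (Equiv.refl Bool x)) = M a := by simp
  exact (congrArg (fun S => update S (Sum.inl b : Stk tm)
      (((M a).map fun x => id (Equiv.refl Bool x)).reverse ++ M b)) (update_state tm M a [])).trans
    ((update_state tm _ b _).trans (by rw [hl]))

/-- Empties the register `k`. -/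
def clear (k : Reg) : Prog tm := loop k Option.isSome (pop k)

theorem does_clear (k : Reg) (M : Reg → List Bool) :
    (clear k : Prog tm).Does M (update M k []) (2 * (M k).length + 1) := by
  generalize hl : M k = l
  induction l generalizing M with
  | nil =>
    have : update M k [] = M := by rw [← hl, update_eq_self]
    rw [this]
    exact Does.loop_done (by simp [hl])
  | cons x l ih =>
    have h1 := does_pop (tm := tm) k M
    rw [hl] at h1
    have h2 := ih (update M k l) (by simp)
    rw [update_idem] at h2
    exact (Does.loop_step (by simp [hl]) h1 h2).mono (by simp; omega)

end Prog

end Registers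

section Call

variable {ι : Type} {γ : ι → List Bool → Option (List Bool)}
  (C : ∀ i, TM2ComputableInPolyTime (fun x : List Bool => x) encodeOutput (γ i))

/-- The machines of a family of computability witnesses. -/
abbrev machines (i : ι) : FinTM2 := (C i).tm

namespace Prog

/-- Applies `γ i` to the word in the register `word`, which is stored in reverse, last letter on
top. If `γ i` is undefined there, the register `word` is emptied and `true` is pushed on
`flag`. -/
def call (i : ι) : Prog (machines C) :=
  Routine.call (Γ := Alph (machines C)) (Sum.inl word) (Sum.inl flag) (Equiv.refl Bool) true
    (fun k : (C i).tm.K => Sum.inr ⟨i, k⟩) (routineOf (C i).tm) (C i).tm.k₀ (C i).tm.k₁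
    (C i).inputAlphabet (C i).outputAlphabet

theorem injective_inr_mk (i : ι) :
    Injective (fun k => Sum.inr ⟨i, k⟩ : (C i).tm.K → Stk (machines C)) := by
  intro k k' h
  simpa using h

theorem does_call_none [DecidableEq ι] {i : ι} {M : Reg → List Bool}
    (h : γ i (M word).reverse = none) :
    (call C i).Does M (update (update M word []) flag (true :: M flag))
      (4 * (M word).length + (C i).time.eval (M word).length + 3) := by
  have h1 := runs_routineOf ((C i).outputsFun (M word).reverse)
  rw [h, List.length_reverse] at h1
  refine (Routine.runs_call_none (Γ := Alph (machines C)) (S := state (machines C) M)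
    (w := M word) (injective_inr_mk C i) (by simp) (by simp) (fun _ => rfl)
    (List.map_id _) h1).congr rfl ?_
  exact (congrArg (fun S => update S (Sum.inl flag : Stk (machines C)) (true :: M flag))
    (update_state (machines C) M word [])).trans (update_state (machines C) _ flag _)

theorem does_call_some [DecidableEq ι] {i : ι} {M : Reg → List Bool} {z : List Bool}
    (h : γ i (M word).reverse = some z) :
    (call C i).Does M (update M word z.reverse)
      (4 * (M word).length + (C i).time.eval (M word).length + 4 * z.length + 4) := by
  have h1 := runs_routineOf ((C i).outputsFun (M word).reverse)
  rw [h, List.length_reverse] at h1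
  refine (Routine.runs_call_some (Γ := Alph (machines C)) (S := state (machines C) M)
    (w := M word) (injective_inr_mk C i) (by simp) (fun _ => rfl)
    (List.map_id _) h1).congr rfl ?_
  refine (congrArg (update (state (machines C) M) (Sum.inl word)) ?_).trans
    (update_state (machines C) M word _)
  exact List.map_id _

end Prog

end Call

/-- A register program that turns the input into the encoded output in polynomial time, leaving
all other registers empty, is a polynomial-time machine in the sense of Mathlib. -/
theorem isPolyTime_of_does {ι : Type} [DecidableEq ι] [Fintype ι] {tm : ι → FinTM2}
    {h : PartialWordFun} (P : Prog tm) (T : Polynomial ℕ)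
    (hP : ∀ x, P.Does (mem x [] [] [] [] [] [] []) (mem (encodeOutput (h x)) [] [] [] [] [] [] [])
      (T.eval x.length)) : h.IsPolyTime := by
  let := fun i => (tm i).kFin
  let M : FinTM2 :=
    { K := Stk tm
      k₀ := Sum.inl input
      k₁ := Sum.inl input
      Γ := Alph tm
      Λ := P.Λ
      main := P.main
      σ := P.σ
      initialState := P.start
      Γk₀Fin := inferInstanceAs (Fintype Bool)
      m := P.prog }
  have hst : ∀ x : List Bool, (update (fun _ => []) (Sum.inl input) x : ∀ k, List (Alph tm k)) =
      state tm (mem x [] [] [] [] [] [] []) := by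
    intro x
    have h0 : (fun _ => [] : ∀ k, List (Alph tm k)) =
        state tm (mem [] [] [] [] [] [] [] []) := by
      funext k
      rcases k with k | k
      · cases k <;> rfl
      · rfl
    rw [h0]
    exact (update_state tm _ input x).trans (by rw [update_mem_input])
  have e1 : ∀ x, initList M x = ⟨some P.main, P.start, state tm (mem x [] [] [] [] [] [] [])⟩ :=
    fun x => congrArg (TM2.Cfg.mk (some P.main) P.start) ((initList_stk M x).trans (hst x))
  have e2 : ∀ x, haltList M x = ⟨none, P.start, state tm (mem x [] [] [] [] [] [] [])⟩ :=
    fun x => congrArg (TM2.Cfg.mk none P.start) ((haltList_stk M x).trans (hst x))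
  refine ⟨⟨⟨M, Equiv.refl Bool, Equiv.refl Bool⟩, T, fun x => ?_⟩⟩
  -- The goal is a structure with data, while `hP` only asserts the existence of a run.
  apply Classical.choice
  obtain ⟨n, hn, hx⟩ := hP x
  refine ⟨⟨⟨n, ?_⟩, hn⟩⟩
  have e3 : ∀ x : List Bool, x.map (Equiv.refl Bool).invFun = x := List.map_id
  change _ = some (haltList M ((encodeOutput (h x)).map (Equiv.refl Bool).invFun))
  refine Eq.trans ?_ (Eq.trans hx ?_)
  · exact congrArg (fun c => (flip bind (TM2.step P.prog))^[n] (some c))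
      ((congrArg (initList M) (e3 x)).trans (e1 x))
  · exact congrArg some ((congrArg (haltList M) (e3 _)).trans (e2 _)).symm

/-! ### The monoid of right-ideal morphisms -/

theorem eval_le_eval (p : Polynomial ℕ) {m n : ℕ} (h : m ≤ n) : p.eval m ≤ p.eval n := by
  induction p using Polynomial.induction_on' with
  | add p q hp hq => simpa using add_le_add hp hq
  | monomial k a =>
    simp only [Polynomial.eval_monomial]
    gcongr

theorem IsPolyBalanced.mul {f g : PartialWordFun} (hf : f.IsPolyBalanced)
    (hg : g.IsPolyBalanced) : (f * g).IsPolyBalanced := by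
  obtain ⟨p, q, hf⟩ := hf
  obtain ⟨p', q', hg⟩ := hg
  refine ⟨p.comp p', q'.comp q, fun x y hxy => ?_⟩
  obtain ⟨z, hz, hy⟩ := Option.bind_eq_some_iff.1 hxy
  simp only [Polynomial.eval_comp]
  exact ⟨(hf z y hy).1.trans (eval_le_eval p (hg x z hz).1),
    (hg x z hz).2.trans (eval_le_eval q' (hf z y hy).2)⟩

theorem IsRightIdealMorphism.mul {f g : PartialWordFun} (hf : f.IsRightIdealMorphism)
    (hg : g.IsRightIdealMorphism) : (f * g).IsRightIdealMorphism := by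
  intro x y hxy w
  obtain ⟨z, hz, hy⟩ := Option.bind_eq_some_iff.1 hxy
  exact Option.bind_eq_some_iff.2 ⟨_, hg x z hz w, hf z y hy w⟩

/-- The composite machine runs the machine of `g`, and then that of `f` on the output. Balance is
only used to bound the lengths of the intermediate and of the final word. -/
theorem IsPolyTime.mul {f g : PartialWordFun} (hf : f.IsPolyTime) (hg : g.IsPolyTime)
    (hf' : f.IsPolyBalanced) (hg' : g.IsPolyBalanced) : (f * g).IsPolyTime := by
  obtain ⟨Cf⟩ := hf
  obtain ⟨Cg⟩ := hg
  obtain ⟨p, _, hp⟩ := hf'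
  obtain ⟨p', _, hp'⟩ := hg'
  let γ : Bool → List Bool → Option (List Bool) := fun b => cond b g f
  let C : ∀ b, TM2ComputableInPolyTime (fun x : List Bool => x) encodeOutput (γ b)
    | true => Cg
    | false => Cf
  let P : Prog (machines C) :=
    (Prog.move input word).seq <| (Prog.call C true).seq <|
      Prog.ite flag Option.isSome (Prog.pop flag) <|
      (Prog.call C false).seq <| Prog.ite flag Option.isSome (Prog.pop flag) <|
      (Prog.move word input).seq (Prog.push input true)
  refine isPolyTime_of_does P (8 * Polynomial.X + Cg.time + 8 * p' + Cf.time.comp p' +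
    8 * p.comp p' + 30) fun x => ?_
  simp only [Polynomial.eval_add, Polynomial.eval_mul, Polynomial.eval_X, Polynomial.eval_comp,
    Polynomial.eval_ofNat]
  have h1 : (Prog.move input word : Prog (machines C)).Does (mem x [] [] [] [] [] [] [])
      (mem [] [] [] [] x.reverse [] [] []) (4 * x.length + 1) := by
    simpa using Prog.does_move (tm := machines C) (a := input) (b := word) (by decide)
      (mem x [] [] [] [] [] [] [])
  have hpop : (Prog.pop flag : Prog (machines C)).Does (mem [] [] [] [] [] [] [] [true])
      (mem [] [] [] [] [] [] [] []) 1 := by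
    simpa using Prog.does_pop (tm := machines C) flag (mem [] [] [] [] [] [] [] [true])
  cases hgx : g x with
  | none =>
    have h2 := Prog.does_call_none C (i := true) (M := mem [] [] [] [] x.reverse [] [] [])
      (show g x.reverse.reverse = none by rwa [List.reverse_reverse])
    simp only [update_mem_word, update_mem_flag, mem_word, mem_flag, List.length_reverse] at h2
    have hfg : (f * g) x = none := by
      change (g x).bind f = none
      rw [hgx]
      rfl
    rw [hfg]
    refine (h1.seq (h2.seq (Prog.Does.ite_true rfl hpop))).mono ?_
    change 4 * x.length + 1 + (4 * x.length + Cg.time.eval x.length + 3 + (1 + 1)) ≤ _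
    omega
  | some z =>
    have h2 := Prog.does_call_some C (i := true) (M := mem [] [] [] [] x.reverse [] [] [])
      (show g x.reverse.reverse = some z by rwa [List.reverse_reverse])
    simp only [update_mem_word, mem_word, List.length_reverse] at h2
    have hz := (hp' x z hgx).1
    have hT := eval_le_eval Cf.time hz
    have hfg : (f * g) x = f z := by
      change (g x).bind f = _
      rw [hgx]
      rfl
    rw [hfg]
    cases hfz : f z with
    | none =>
      have h3 := Prog.does_call_none C (i := false) (M := mem [] [] [] [] z.reverse [] [] [])
        (show f z.reverse.reverse = none by rwa [List.reverse_reverse])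
      simp only [update_mem_word, update_mem_flag, mem_word, mem_flag, List.length_reverse] at h3
      refine (h1.seq (h2.seq (Prog.Does.ite_false rfl
        (h3.seq (Prog.Does.ite_true rfl hpop))))).mono ?_
      change 4 * x.length + 1 + (4 * x.length + Cg.time.eval x.length + 4 * z.length + 4 +
        (4 * z.length + Cf.time.eval z.length + 3 + (1 + 1) + 1)) ≤ _
      omega
    | some y =>
      have h3 := Prog.does_call_some C (i := false) (M := mem [] [] [] [] z.reverse [] [] [])
        (show f z.reverse.reverse = some y by rwa [List.reverse_reverse])
      simp only [update_mem_word, mem_word, List.length_reverse] at h3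
      have h4 : (Prog.move word input : Prog (machines C)).Does
          (mem [] [] [] [] y.reverse [] [] []) (mem y [] [] [] [] [] [] [])
          (4 * y.length + 1) := by
        simpa using Prog.does_move (tm := machines C) (a := word) (b := input) (by decide)
          (mem [] [] [] [] y.reverse [] [] [])
      have h5 : (Prog.push input true : Prog (machines C)).Does
          (mem y [] [] [] [] [] [] []) (mem (true :: y) [] [] [] [] [] [] []) 1 := by
        simpa using Prog.does_push (tm := machines C) input true (mem y [] [] [] [] [] [] [])
      have hy := (hp z y hfz).1.trans (eval_le_eval p hz)
      refine (h1.seq (h2.seq (Prog.Does.ite_false rfl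
        (h3.seq (Prog.Does.ite_false rfl (h4.seq h5)))))).mono ?_
      change 4 * x.length + 1 + (4 * x.length + Cg.time.eval x.length + 4 * z.length + 4 +
        (4 * z.length + Cf.time.eval z.length + 4 * y.length + 4 +
          (4 * y.length + 1 + 1 + 1) + 1)) ≤ _
      omega

theorem one_mem_RM2P : (1 : PartialWordFun) ∈ RM2P := by
  refine ⟨⟨⟨Polynomial.X, Polynomial.X, fun x y h => ?_⟩, ?_⟩, fun x y h w => ?_⟩
  · obtain rfl : x = y := Option.some.inj h
    simp
  · refine isPolyTime_of_does (ι := Empty) (tm := Empty.elim) (Prog.push input true) 1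
      fun x => ?_
    have := Prog.does_push (tm := Empty.elim) input true (mem x [] [] [] [] [] [] [])
    simp only [update_mem_input, mem_input] at this
    rw [Polynomial.eval_one]
    exact this
  · obtain rfl : x = y := Option.some.inj h
    rfl

theorem mul_mem_RM2P {f g : PartialWordFun} (hf : f ∈ RM2P) (hg : g ∈ RM2P) : f * g ∈ RM2P :=
  ⟨⟨hf.1.1.mul hg.1.1, hf.1.2.mul hg.1.2 hf.1.1 hg.1.1⟩, hf.2.mul hg.2⟩

/-- The monoid `RM₂ᴾ`. -/
def monoidRM2P : Submonoid PartialWordFun where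
  carrier := RM2P
  mul_mem' := mul_mem_RM2P
  one_mem' := one_mem_RM2P

/-! ### The diagonal function -/

/-- The finite sequence of the functions `γ i`, for `i` in the list `is`, continued by nowhere
defined functions to a sequence over all of `ℕ`. -/
def nthFun {ι : Type} (γ : ι → List Bool → Option (List Bool)) (is : List ι) (j : ℕ) : PartialWordFun :=
  fun z => is[j]?.bind fun i => γ i z

/-- Splits off the header of a word, which consists of blocks `1c` and a final `0`: the letters `c`
are pushed on `w`, all letters that are read are pushed on `r`, and the third component of the
result is what follows the header. Headers form a prefix code. As `w` is a stack, the letters `c`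
are listed backwards, and so are the letters in `r`. -/
def parse : List Bool → List Bool → List Bool → Option (List Bool × List Bool × List Bool)
  | w, r, true :: c :: v => parse (c :: w) (c :: true :: r) v
  | w, r, false :: v => some (w, false :: r, v)
  | _, _, _ => none

/-- The test that defines the diagonal function. The second argument is a word over the generators
`g 0, g 1, …` in which the generator `g i` is written `1ⁱ0`; the first argument counts the letters
`1` read so far in the current block. With current value `z` and remaining input `v`, each
generator `g i` asks for `|z|` zeros at the beginning of `v`. If they are missing, the input is
rejected; if `g i` is undefined on `z 0^|z|`, the input is accepted; otherwise the value of `g i`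
there is the next `z`. If all generators could be applied, one more zero is asked for. -/
def Accepts (g : ℕ → PartialWordFun) : ℕ → List Bool → List Bool → List Bool → Prop
  | _, [], _, v => v.head? = some false
  | j, true :: w, z, v => Accepts g (j + 1) w z v
  | j, false :: w, z, v => List.replicate z.length false <+: v ∧
      ∀ z', g j (z ++ List.replicate z.length false) = some z' →
        Accepts g 0 w z' (v.drop z.length)

/-- The product of the generators that are encoded in a word as in `Accepts`; the generator that
is read first is applied first. -/
def wordProduct (g : ℕ → PartialWordFun) : ℕ → List Bool → PartialWordFun
  | _, [] => 1
  | j, true :: w => wordProduct g (j + 1) w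
  | j, false :: w => wordProduct g 0 w * g j

/-- The domain of the diagonal function. -/
def DiagDom (g : ℕ → PartialWordFun) (x : List Bool) : Prop :=
  ∃ w r v, parse [] [] x = some (w, r, v) ∧ Accepts g 0 w r.reverse v

open Classical in
/-- The identity, restricted to `DiagDom g`. -/
noncomputable def diag (g : ℕ → PartialWordFun) : PartialWordFun :=
  fun x => if DiagDom g x then some x else none

theorem parse_append {w r x w' r' v : List Bool} (h : parse w r x = some (w', r', v))
    (y : List Bool) : parse w r (x ++ y) = some (w', r', v ++ y) := by
  fun_induction parse w r x with
  | case1 w r c v ih => exact ih h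
  | case2 w r v =>
    obtain ⟨rfl, rfl, rfl⟩ : w = w' ∧ false :: r = r' ∧ _ = _ := by simpa using h
    rfl
  | case3 => simp at h

theorem parse_header (l w r v : List Bool) :
    parse w r (l.flatMap (fun c => [true, c]) ++ false :: v) =
      some (l.reverse ++ w, false :: ((l.flatMap fun c => [true, c]).reverse ++ r), v) := by
  induction l generalizing w r with
  | nil => simp [parse]
  | cons c l ih => simp [parse, ih]

theorem exists_header (w : List Bool) :
    ∃ b, ∀ v, parse [] [] (b ++ v) = some (w, b.reverse, v) := by
  refine ⟨w.reverse.flatMap (fun c => [true, c]) ++ [false], fun v => ?_⟩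
  rw [List.append_assoc, List.singleton_append, parse_header]
  simp

theorem Accepts.append {g : ℕ → PartialWordFun} {j : ℕ} {w z v : List Bool}
    (h : Accepts g j w z v) (y : List Bool) : Accepts g j w z (v ++ y) := by
  fun_induction Accepts g j w z v with
  | case1 => simp_all [Accepts, List.head?_append]
  | case2 j w z v ih => exact ih h
  | case3 j w z v ih =>
    refine ⟨h.1.trans (List.prefix_append _ _), fun z' hz' => ?_⟩
    have := ih z' (h.2 z' hz')
    rwa [List.drop_append_of_le_length (by simpa using h.1.length_le)]

theorem diag_isRightIdealMorphism (g : ℕ → PartialWordFun) : (diag g).IsRightIdealMorphism := by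
  intro x y hxy u
  unfold diag at hxy ⊢
  split_ifs at hxy with hx
  obtain rfl := Option.some.inj hxy
  obtain ⟨w, r, v, h1, h2⟩ := hx
  exact if_pos ⟨w, r, v ++ u, parse_append h1 u, h2.append u⟩

theorem diag_isPolyBalanced (g : ℕ → PartialWordFun) : (diag g).IsPolyBalanced := by
  refine ⟨Polynomial.X, Polynomial.X, fun x y hxy => ?_⟩
  unfold diag at hxy
  split_ifs at hxy
  obtain rfl := Option.some.inj hxy
  simp

/-- Every element of the submonoid generated by the `g j` is encoded by some word. -/
theorem exists_wordProduct_eq {g : ℕ → PartialWordFun} {f : PartialWordFun}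
    (hf : f ∈ Submonoid.closure (Set.range g)) : ∃ w, wordProduct g 0 w = f := by
  induction hf using Submonoid.closure_induction_right with
  | one => exact ⟨[], rfl⟩
  | mul_right f hf y hy ih =>
    obtain ⟨j, rfl⟩ := hy
    obtain ⟨w, rfl⟩ := ih
    have key : ∀ i, wordProduct g i (List.replicate j true ++ false :: w) =
        wordProduct g 0 w * g (i + j) := by
      induction j with
      | zero => intro i; rfl
      | succ j ih =>
        intro i
        rw [List.replicate_succ, List.cons_append, wordProduct, ih, add_right_comm, add_assoc]
    exact ⟨_, (key 0).trans (by rw [zero_add])⟩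

/-- The diagonal argument. The inputs considered are `z 0ⁿ` for fixed `z`. If some generator stays
undefined after the `|z|` zeros it asks for, then the whole product is undefined on an accepted
input; here it matters that the generators are right-ideal morphisms, so that the zeros not yet
consumed do not influence the earlier generators. If all generators are defined, then so is the
product, already one zero before the input is accepted. -/
theorem exists_accepts {g : ℕ → PartialWordFun} (hg : ∀ j, (g j).IsRightIdealMorphism) (j : ℕ)
    (w z : List Bool) : ∃ n, Accepts g j w z (List.replicate n false) ∧
      (wordProduct g j w (z ++ List.replicate n false) = none ∨
        ∃ n', ¬ Accepts g j w z (List.replicate n' false) ∧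
          wordProduct g j w (z ++ List.replicate n' false) ≠ none) := by
  induction w generalizing j z with
  | nil =>
    -- The empty product is defined without any zero, but acceptance requires one.
    exact ⟨1, rfl, Or.inr ⟨0, by simp [Accepts], by exact Option.some_ne_none _⟩⟩
  | cons c w ih =>
    cases c with
    | true => exact ih (j + 1) z
    | false =>
      cases hz : g j (z ++ List.replicate z.length false) with
      | none =>
        -- Accepted as soon as the zeros that `g j` asks for are there, but `g j` is undefined.
        refine ⟨z.length, ⟨List.prefix_rfl, by simp [hz]⟩, Or.inl ?_⟩
        change (g j _).bind _ = none
        rw [hz]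
        rfl
      | some z' =>
        have hacc : ∀ n, Accepts g j (false :: w) z (List.replicate (z.length + n) false) ↔
            Accepts g 0 w z' (List.replicate n false) := by
          intro n
          rw [List.replicate_add]
          simp [Accepts, hz, -List.replicate_append_replicate]
        have hrun : ∀ n, wordProduct g j (false :: w) (z ++ List.replicate (z.length + n) false) =
            wordProduct g 0 w (z' ++ List.replicate n false) := by
          intro n
          change (g j _).bind _ = _
          rw [List.replicate_add, ← List.append_assoc, hg j _ _ hz]
          rfl
        obtain ⟨n, h1, h2⟩ := ih 0 z'
        refine ⟨z.length + n, (hacc n).2 h1, ?_⟩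
        rw [hrun]
        refine h2.imp id fun ⟨n', h3, h4⟩ => ⟨z.length + n', ?_, ?_⟩
        · rwa [hacc]
        · rwa [hrun]

/-- The diagonal function differs from every product of the `g j`, on inputs of the form `b 0ⁿ`
where `b` is the header that encodes the product. -/
theorem diag_notMem_closure {g : ℕ → PartialWordFun} (hg : ∀ j, (g j).IsRightIdealMorphism) :
    diag g ∉ Submonoid.closure (Set.range g) := by
  intro h
  obtain ⟨w, hw⟩ := exists_wordProduct_eq h
  obtain ⟨b, hb⟩ := exists_header w
  have hdom : ∀ v, DiagDom g (b ++ v) ↔ Accepts g 0 w b v := by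
    intro v
    simp only [DiagDom, hb, Option.some.injEq, Prod.mk.injEq]
    constructor
    · rintro ⟨w', r', v', ⟨rfl, rfl, rfl⟩, h⟩
      rwa [List.reverse_reverse] at h
    · exact fun h => ⟨w, b.reverse, v, ⟨rfl, rfl, rfl⟩, by rwa [List.reverse_reverse]⟩
  obtain ⟨n, h1, h2 | ⟨n', h3, h4⟩⟩ := exists_accepts hg 0 w b
  · rw [hw, diag, if_pos ((hdom _).2 h1)] at h2
    simp at h2
  · rw [hw, diag, if_neg (fun h => h3 ((hdom _).1 h))] at h4
    exact h4 rfl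

/-! ### A polynomial-time machine for the diagonal function -/

namespace Prog

section Registers

variable {ι : Type} [DecidableEq ι] {tm : ι → FinTM2}

theorem Does.congr {P : Prog tm} {M M' M'' : Reg → List Bool} {t : ℕ} (h : P.Does M M' t)
    (h' : M' = M'') : P.Does M M'' t :=
  h' ▸ h

variable (tm) in
/-- Empties all registers but `input`. -/
def reset : Prog tm :=
  (clear aux).seq <| (clear rest).seq <| (clear code).seq <| (clear word).seq <|
    (clear tmp).seq <| (clear index).seq (clear flag)

theorem does_reset (x a v w r z j f : List Bool) :
    (reset tm).Does (mem x a v w r z j f) (mem x [] [] [] [] [] [] [])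
      (2 * (a.length + v.length + w.length + r.length + z.length + j.length + f.length) + 7) := by
  have h1 := does_clear (tm := tm) aux (mem x a v w r z j f)
  have h2 := does_clear (tm := tm) rest (mem x [] v w r z j f)
  have h3 := does_clear (tm := tm) code (mem x [] [] w r z j f)
  have h4 := does_clear (tm := tm) word (mem x [] [] [] r z j f)
  have h5 := does_clear (tm := tm) tmp (mem x [] [] [] [] z j f)
  have h6 := does_clear (tm := tm) index (mem x [] [] [] [] [] j f)
  have h7 := does_clear (tm := tm) flag (mem x [] [] [] [] [] [] f)
  simp only [update_mem_aux, update_mem_rest, update_mem_code, update_mem_word, update_mem_tmp,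
    update_mem_index, update_mem_flag, mem_aux, mem_rest, mem_code, mem_word, mem_tmp, mem_index,
    mem_flag] at h1 h2 h3 h4 h5 h6 h7
  exact (h1.seq (h2.seq (h3.seq (h4.seq (h5.seq (h6.seq h7)))))).mono (by omega)

variable (tm) in
/-- Empties `aux` onto both `input` and `rest`. -/
def duplicate : Prog tm :=
  loop aux Option.isSome <| ite aux (· == some true)
    ((pop aux).seq ((push input true).seq (push rest true)))
    ((pop aux).seq ((push input false).seq (push rest false)))

theorem does_duplicate (x a v w r z j f : List Bool) :
    (duplicate tm).Does (mem x a v w r z j f) (mem (a.reverse ++ x) [] (a.reverse ++ v) w r z j f)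
      (5 * a.length + 1) := by
  induction a generalizing x v with
  | nil => exact Does.loop_done rfl
  | cons c a ih =>
    have h : ∀ c, Does (tm := tm) ((pop aux).seq ((push input c).seq (push rest c)))
        (mem x (c :: a) v w r z j f) (mem (c :: x) a (c :: v) w r z j f) 3 := by
      intro c
      have h1 := does_pop (tm := tm) aux (mem x (c :: a) v w r z j f)
      have h2 := does_push (tm := tm) input c (mem x a v w r z j f)
      have h3 := does_push (tm := tm) rest c (mem (c :: x) a v w r z j f)
      simp only [update_mem_aux, mem_aux, List.tail_cons, update_mem_input, mem_input,
        update_mem_rest, mem_rest] at h1 h2 h3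
      exact h1.seq (h2.seq h3)
    have h4 := ih (c :: x) (c :: v)
    simp only [List.reverse_cons, List.append_assoc, List.singleton_append, List.length_cons]
    cases c
    · exact (Does.loop_step rfl (Does.ite_false rfl (h false)) h4).mono (by omega)
    · exact (Does.loop_step rfl (Does.ite_true rfl (h true)) h4).mono (by omega)

variable (tm) in
/-- Reads the blocks `1c` of the header, as `parse` does. -/
def readBlocks : Prog tm :=
  loop rest (· == some true) <| (pop rest).seq <| (push word true).seq <|
    ite rest (· == some true) ((pop rest).seq ((push code true).seq (push word true))) <|
    ite rest (· == some false) ((pop rest).seq ((push code false).seq (push word false))) skip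

/-- The final `0` of the header is left on `rest`, since the loop stops when it sees it. -/
theorem does_readBlocks (x u w r : List Bool) :
    ∃ v' w' r', (readBlocks tm).Does (mem x [] u w r [] [] []) (mem x [] v' w' r' [] [] [])
        (8 * u.length + 1) ∧
      v'.length ≤ u.length ∧ w'.length ≤ w.length + u.length ∧ r'.length ≤ r.length + u.length ∧
      ((parse w r u = none ∧ v' = []) ∨
        ∃ v'', v' = false :: v'' ∧ parse w r u = some (w', false :: r', v'')) := by
  have hbody : ∀ c u w r, Does (tm := tm) ((pop rest).seq ((push code c).seq (push word c)))
        (mem x [] (c :: u) w r [] [] []) (mem x [] u (c :: w) (c :: r) [] [] []) 3 := by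
    intro c u w r
    have h1 := does_pop (tm := tm) rest (mem x [] (c :: u) w r [] [] [])
    have h2 := does_push (tm := tm) code c (mem x [] u w r [] [] [])
    have h3 := does_push (tm := tm) word c (mem x [] u (c :: w) r [] [] [])
    simp only [update_mem_rest, mem_rest, List.tail_cons, update_mem_code, mem_code,
      update_mem_word, mem_word] at h1 h2 h3
    exact h1.seq (h2.seq h3)
  have hmark : ∀ u w r, Does (tm := tm) (pop rest) (mem x [] (true :: u) w r [] [] [])
      (mem x [] u w r [] [] []) 1 ∧ Does (tm := tm) (push word true) (mem x [] u w r [] [] [])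
      (mem x [] u w (true :: r) [] [] []) 1 := fun u w r =>
    ⟨(does_pop (tm := tm) rest _).congr (by simp), (does_push (tm := tm) word true _).congr
      (by simp)⟩
  fun_induction parse w r u with
  | case1 w r c u ih =>
    obtain ⟨v', w', r', h, h1, h2, h3, h4⟩ := ih
    refine ⟨v', w', r', ?_, by simp; omega, by simp at h2 ⊢; omega, by simp at h3 ⊢; omega, h4⟩
    obtain ⟨g1, g2⟩ := hmark (c :: u) w r
    cases c
    · exact (Does.loop_step rfl (g1.seq (g2.seq (Does.ite_false rfl (Does.ite_true rfl
        (hbody _ _ _ _))))) h).mono (by simp; omega)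
    · exact (Does.loop_step rfl (g1.seq (g2.seq (Does.ite_true rfl
        (hbody _ _ _ _)))) h).mono (by simp; omega)
  | case2 w r v =>
    exact ⟨_, _, _, (Does.loop_done rfl).mono (by omega), le_rfl, by omega, by omega,
      Or.inr ⟨v, rfl, rfl⟩⟩
  | case3 u w r h1 h2 =>
    rcases u with _ | ⟨_ | _, _ | ⟨c, u⟩⟩
    · exact ⟨_, _, _, (Does.loop_done rfl).mono (by omega), le_rfl, by omega, by omega,
        Or.inl ⟨rfl, rfl⟩⟩
    · exact absurd rfl (h2 _)
    · exact absurd rfl (h2 _)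
    · obtain ⟨g1, g2⟩ := hmark [] w r
      exact ⟨_, _, _, (Does.loop_step rfl (g1.seq (g2.seq (Does.ite_false rfl (Does.ite_false rfl
        (does_skip _))))) (Does.loop_done rfl)).mono (by simp), by simp, by simp, by simp,
        Or.inl ⟨rfl, rfl⟩⟩
    · exact absurd rfl (h1 _ _)

variable (tm) in
/-- Moves the contents of `word` to `tmp`, and for each letter moves a zero from `rest` to `aux`,
or raises the flag if `rest` does not begin with a zero. -/
def matchZeros : Prog tm :=
  loop word Option.isSome <|
    (ite word (· == some true) ((pop word).seq (push tmp true))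
      ((pop word).seq (push tmp false))).seq <|
    ite rest (· == some false) ((pop rest).seq (push aux false)) (push flag true)

theorem does_matchZeros (x a v w r z j f : List Bool) :
    ∃ a' v' f', (matchZeros tm).Does (mem x a v w r z j f)
        (mem x a' v' w [] (r.reverse ++ z) j f') (7 * r.length + 1) ∧
      a'.length ≤ a.length + r.length ∧ v'.length ≤ v.length ∧ f.length ≤ f'.length ∧
      f'.length ≤ f.length + r.length ∧
      ((List.replicate r.length false <+: v ∧ a' = List.replicate r.length false ++ a ∧
          v' = v.drop r.length ∧ f' = f) ∨
        ¬ List.replicate r.length false <+: v ∧ f.length < f'.length) := by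
  induction r generalizing a v z f with
  | nil =>
    exact ⟨a, v, f, Does.loop_done rfl, by simp, le_rfl, le_rfl, by simp,
      Or.inl ⟨by simp, rfl, rfl, rfl⟩⟩
  | cons c r ih =>
    have hmove : (ite word (· == some true) ((pop word).seq (push tmp true))
        ((pop word).seq (push tmp false)) : Prog tm).Does (mem x a v w (c :: r) z j f)
          (mem x a v w r (c :: z) j f) 3 := by
      have h : ∀ c, Does (tm := tm) ((pop word).seq (push tmp c)) (mem x a v w (c :: r) z j f)
          (mem x a v w r (c :: z) j f) 2 := by
        intro c
        have h1 := does_pop (tm := tm) word (mem x a v w (c :: r) z j f)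
        have h2 := does_push (tm := tm) tmp c (mem x a v w r z j f)
        simp only [update_mem_word, mem_word, List.tail_cons, update_mem_tmp, mem_tmp] at h1 h2
        exact h1.seq h2
      cases c
      · exact Does.ite_false rfl (h _)
      · exact Does.ite_true rfl (h _)
    by_cases hv : ∃ u, v = false :: u
    · obtain ⟨u, rfl⟩ := hv
      have h1 := does_pop (tm := tm) rest (mem x a (false :: u) w r (c :: z) j f)
      have h2 := does_push (tm := tm) aux false (mem x a u w r (c :: z) j f)
      simp only [update_mem_rest, mem_rest, List.tail_cons, update_mem_aux, mem_aux] at h1 h2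
      obtain ⟨a', v', f', h, b1, b2, b3, b4, h3⟩ := ih (false :: a) u (c :: z) f
      refine ⟨a', v', f', ?_, by simp at b1 ⊢; omega, by simp; omega, b3, by simp; omega, ?_⟩
      · rw [List.reverse_cons, List.append_assoc]
        exact (Does.loop_step rfl (hmove.seq (Does.ite_true rfl (h1.seq h2))) h).mono
          (by simp; omega)
      · rw [List.length_cons, List.replicate_succ, List.cons_prefix_cons]
        rcases h3 with ⟨p1, p2, p3, p4⟩ | ⟨p1, p2⟩
        · refine Or.inl ⟨⟨rfl, p1⟩, ?_, p3, p4⟩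
          rw [p2, ← List.replicate_succ, List.replicate_succ', List.append_assoc]
          rfl
        · exact Or.inr ⟨fun h => p1 h.2, p2⟩
    · have h1 := does_push (tm := tm) flag true (mem x a v w r (c :: z) j f)
      simp only [update_mem_flag, mem_flag] at h1
      obtain ⟨a', v', f', h, b1, b2, b3, b4, h3⟩ := ih a v (c :: z) (true :: f)
      simp only [List.length_cons] at b3 b4
      refine ⟨a', v', f', ?_, by simp; omega, b2, by omega, by simp; omega,
        Or.inr ⟨fun h => ?_, by omega⟩⟩
      · rw [List.reverse_cons, List.append_assoc]
        refine (Does.loop_step rfl (hmove.seq (Does.ite_false ?_ h1)) h).mono (by simp; omega)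
        rcases v with _ | ⟨_ | _, v⟩
        · rfl
        · exact absurd ⟨v, rfl⟩ hv
        · rfl
      · rw [List.length_cons, List.replicate_succ] at h
        obtain ⟨t, rfl⟩ := h
        exact hv ⟨_, rfl⟩

end Registers

section Simulation

variable {ι : Type} {γ : ι → List Bool → Option (List Bool)}
  (C : ∀ i, TM2ComputableInPolyTime (fun x : List Bool => x) encodeOutput (γ i))

/-- Calls the member of the list whose position is stored in unary in `index`. A position past the
end of the list raises the flag, as an undefined value does. -/
def dispatch : List ι → Prog (machines C)
  | [] => push flag true
  | i :: is => ite index Option.isSome ((pop index).seq (dispatch is)) (call C i)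

variable [DecidableEq ι] {C}

theorem does_dispatch_some {x v w r y : List Bool} {j T : ℕ} {is : List ι}
    (hT : ∀ i, (C i).time.eval r.length ≤ T) (h : nthFun γ is j r.reverse = some y) :
    (dispatch C is).Does (mem x [] v w r [] (List.replicate j true) [])
      (mem x [] v w y.reverse [] [] []) (2 * is.length + 4 * r.length + T + 4 * y.length + 5) := by
  induction is generalizing j with
  | nil => simp [nthFun] at h
  | cons i is ih =>
    cases j with
    | zero =>
      have h1 := does_call_some C (i := i) (M := mem x [] v w r [] [] []) h
      simp only [update_mem_word, mem_word] at h1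
      exact (Does.ite_false rfl h1).mono (by have := hT i; omega)
    | succ j =>
      have h1 := does_pop (tm := machines C) index
        (mem x [] v w r [] (List.replicate (j + 1) true) [])
      simp only [update_mem_index, mem_index, List.replicate_succ, List.tail_cons] at h1
      exact (Does.ite_true rfl (h1.seq (ih h))).mono (by simp; omega)

theorem does_dispatch_none {x v w r : List Bool} {j T : ℕ} {is : List ι}
    (hT : ∀ i, (C i).time.eval r.length ≤ T) (h : nthFun γ is j r.reverse = none) :
    ∃ r' j', r'.length ≤ r.length ∧ j'.length ≤ j ∧
    (dispatch C is).Does (mem x [] v w r [] (List.replicate j true) [])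
      (mem x [] v w r' [] j' [true]) (2 * is.length + 4 * r.length + T + 5) := by
  induction is generalizing j with
  | nil =>
    have h1 := does_push (tm := machines C) flag true (mem x [] v w r [] (List.replicate j true) [])
    simp only [update_mem_flag, mem_flag] at h1
    exact ⟨r, List.replicate j true, le_rfl, by simp, h1.mono (by omega)⟩
  | cons i is ih =>
    cases j with
    | zero =>
      have h1 := does_call_none C (i := i) (M := mem x [] v w r [] [] []) h
      simp only [update_mem_word, mem_word, update_mem_flag, mem_flag] at h1
      exact ⟨[], [], by simp, by simp, (Does.ite_false rfl h1).mono (by have := hT i; omega)⟩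
    | succ j =>
      have h1 := does_pop (tm := machines C) index
        (mem x [] v w r [] (List.replicate (j + 1) true) [])
      simp only [update_mem_index, mem_index, List.replicate_succ, List.tail_cons] at h1
      obtain ⟨r', j', b1, b2, h2⟩ := ih h
      exact ⟨r', j', b1, by omega, (Does.ite_true rfl (h1.seq h2)).mono (by simp; omega)⟩

variable (C) in
/-- One generator of the simulated word: checks and consumes the zeros that it asks for, and then
applies it to the padded current value. On rejection all registers but `input` are emptied; on
acceptance they are emptied and then a zero is put on `rest`. Both end the simulation, since
`code` becomes empty, and the outcome can be read off from the top of `rest`. -/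
def applyLetter (is : List ι) : Prog (machines C) :=
  (matchZeros _).seq <| (move tmp word).seq <| ite flag Option.isSome (reset _) <|
    (move aux word).seq <| (dispatch C is).seq <|
    ite flag Option.isSome ((reset _).seq (push rest false)) skip

variable (C) in
/-- The simulation that decides `Accepts`: `code` holds the word over the generators, `word` the
current value in reverse, `rest` the remaining input, and `index` counts the letters `1`. -/
def simulate (is : List ι) : Prog (machines C) :=
  loop code Option.isSome <|
    ite code (· == some true) ((pop code).seq (push index true))
      ((pop code).seq (applyLetter C is))

/-- The three outcomes of `applyLetter` correspond to the three cases in the definition of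
`Accepts`. The time bound is uniform, because a generator is only called when `|z| ≤ |v|`, so that
its argument has length at most `2n`; the next value is then bounded by `B`. -/
theorem does_applyLetter {is : List ι} {n B T : ℕ} {x v w r : List Bool} {j : ℕ}
    (hT : ∀ i, ∀ m ≤ 2 * n, (C i).time.eval m ≤ T)
    (hB : ∀ i z y, z.length ≤ 2 * n → γ i z = some y → y.length ≤ B)
    (hv : v.length ≤ n) (hw : w.length ≤ n) (hj : j ≤ n) (hr : r.length ≤ B) :
    ∃ M, (applyLetter C is).Does (mem x [] v w r [] (List.replicate j true) []) M
        (100 * (n + B + T + is.length + 1)) ∧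
      ((¬ List.replicate r.length false <+: v ∧ M = mem x [] [] [] [] [] [] []) ∨
      (List.replicate r.length false <+: v ∧
        nthFun γ is j (r.reverse ++ List.replicate r.length false) = none ∧
        M = mem x [] [false] [] [] [] [] []) ∨
      ∃ y, List.replicate r.length false <+: v ∧
        nthFun γ is j (r.reverse ++ List.replicate r.length false) = some y ∧ y.length ≤ B ∧
        M = mem x [] (v.drop r.length) w y.reverse [] [] []) := by
  obtain ⟨a, v', f, h1, b1, b2, -, b4, h⟩ :=
    does_matchZeros (tm := machines C) x [] v w r [] (List.replicate j true) []
  have h2 := does_move (tm := machines C) (a := tmp) (b := word) (by decide)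
    (mem x a v' w [] (r.reverse ++ []) (List.replicate j true) f)
  simp only [update_mem_tmp, mem_tmp, update_mem_word, mem_word, List.append_nil,
    List.reverse_reverse, List.length_reverse] at h2
  rw [List.append_nil] at h1
  simp only [List.length_nil] at b1 b4
  rcases h with ⟨hz, rfl, rfl, rfl⟩ | ⟨hz, hf⟩
  · have h3 := does_move (tm := machines C) (a := aux) (b := word) (by decide)
      (mem x (List.replicate r.length false ++ []) (v.drop r.length) w r []
        (List.replicate j true) [])
    simp only [update_mem_aux, mem_aux, update_mem_word, mem_word, List.append_nil,
      List.reverse_replicate, List.length_replicate] at h3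
    have hrn : r.length ≤ n := by
      have := hz.length_le
      simp only [List.length_replicate] at this
      omega
    have hT' : ∀ i, (C i).time.eval (List.replicate r.length false ++ r).length ≤ T := by
      intro i
      refine hT i _ ?_
      simp only [List.length_append, List.length_replicate]
      omega
    have hrev : (List.replicate r.length false ++ r).reverse =
        r.reverse ++ List.replicate r.length false := by simp
    simp only [List.append_nil] at h1 h2
    cases hg : nthFun γ is j (r.reverse ++ List.replicate r.length false) with
    | none =>
      rw [← hrev] at hg
      obtain ⟨r', j', c1, c2, h4⟩ := does_dispatch_none (x := x) (v := v.drop r.length) (w := w)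
        hT' hg
      have h5 := does_reset (tm := machines C) x [] (v.drop r.length) w r' [] j' [true]
      have h6 := does_push (tm := machines C) rest false (mem x [] [] [] [] [] [] [])
      simp only [update_mem_rest, mem_rest] at h6
      refine ⟨_, (h1.seq (h2.seq (Does.ite_false rfl (h3.seq (h4.seq (Does.ite_true rfl
        (h5.seq h6))))))).mono ?_, Or.inr (Or.inl ⟨hz, rfl, rfl⟩)⟩
      simp only [List.length_append, List.length_replicate, List.length_nil, List.length_cons] at *
      omega
    | some y =>
      have hy : y.length ≤ B := by
        obtain ⟨i, -, hi⟩ := Option.bind_eq_some_iff.1 hg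
        refine hB i _ y ?_ hi
        simp only [List.length_append, List.length_replicate, List.length_reverse]
        omega
      rw [← hrev] at hg
      have h4 := does_dispatch_some (x := x) (v := v.drop r.length) (w := w) hT' hg
      refine ⟨_, (h1.seq (h2.seq (Does.ite_false rfl (h3.seq (h4.seq (Does.ite_false rfl
        (does_skip _))))))).mono ?_, Or.inr (Or.inr ⟨y, hz, rfl, hy, rfl⟩)⟩
      simp only [List.length_append, List.length_replicate] at *
      omega
  · have h3 := does_reset (tm := machines C) x a v' w r [] (List.replicate j true) f
    rcases f with _ | ⟨b, f⟩
    · simp at hf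
    refine ⟨_, (h1.seq (h2.seq (Does.ite_true rfl h3))).mono ?_, Or.inl ⟨hz, rfl⟩⟩
    simp only [List.length_replicate, List.length_nil] at *
    omega

theorem does_simulate {is : List ι} {n B T : ℕ} {x v w r : List Bool} {j : ℕ}
    (hT : ∀ i, ∀ m ≤ 2 * n, (C i).time.eval m ≤ T)
    (hB : ∀ i z y, z.length ≤ 2 * n → γ i z = some y → y.length ≤ B)
    (hv : v.length ≤ n) (hw : j + w.length ≤ n) (hr : r.length ≤ B) :
    ∃ v' r' j', (simulate C is).Does (mem x [] v w r [] (List.replicate j true) [])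
        (mem x [] v' [] r' [] j' [])
        (w.length * (100 * (n + B + T + is.length + 1) + 3) + 1) ∧
      v'.length ≤ n + 1 ∧ r'.length ≤ B ∧ j'.length ≤ n ∧
      (v'.head? = some false ↔ Accepts (nthFun γ is) j w r.reverse v) := by
  induction w generalizing v r j with
  | nil =>
    exact ⟨v, r, _, (Does.loop_done rfl).mono (by simp), by omega, hr, by simpa using hw, Iff.rfl⟩
  | cons c w ih =>
    have h1 := does_pop (tm := machines C) code
      (mem x [] v (c :: w) r [] (List.replicate j true) [])
    simp only [update_mem_code, mem_code, List.tail_cons] at h1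
    rw [List.length_cons] at hw
    cases c with
    | true =>
      have h2 := does_push (tm := machines C) index true
        (mem x [] v w r [] (List.replicate j true) [])
      simp only [update_mem_index, mem_index, ← List.replicate_succ] at h2
      obtain ⟨v', r', j', h3, b1, b2, b3, h4⟩ := ih (j := j + 1) hv (by omega) hr
      refine ⟨v', r', j', (Does.loop_step rfl (Does.ite_true rfl (h1.seq h2)) h3).mono ?_, b1, b2,
        b3, h4⟩
      rw [List.length_cons, add_mul]
      omega
    | false =>
      obtain ⟨M, h2, ⟨hz, rfl⟩ | ⟨hz, hg, rfl⟩ | ⟨y, hz, hg, hy, rfl⟩⟩ := does_applyLetter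
        (is := is) (j := j) (x := x) (w := w) hT hB hv (by omega) (by omega) hr
      · refine ⟨[], [], [], (Does.loop_step rfl (Does.ite_false rfl (h1.seq h2))
          (Does.loop_done rfl)).mono ?_, by simp, by simp, by simp, ?_⟩
        · rw [List.length_cons, add_mul]
          omega
        · simp [Accepts, hz]
      · refine ⟨[false], [], [], (Does.loop_step rfl (Does.ite_false rfl (h1.seq h2))
          (Does.loop_done rfl)).mono ?_, by simp, by simp, by simp, ?_⟩
        · rw [List.length_cons, add_mul]
          omega
        · simp [Accepts, hz, hg]
      · obtain ⟨v', r', j', h3, b1, b2, b3, h4⟩ := ih (j := 0) (v := v.drop r.length)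
          (r := y.reverse) (by simp; omega) (by omega) (by simpa using hy)
        refine ⟨v', r', j', (Does.loop_step rfl (Does.ite_false rfl (h1.seq h2)) h3).mono ?_, b1,
          b2, b3, ?_⟩
        · rw [List.length_cons, add_mul]
          omega
        · rw [h4]
          simp [Accepts, hz, hg]

variable (C) in
/-- The program for `diag`. A missing header leaves `rest` empty, so that the final test rejects. -/
def diagProg (is : List ι) : Prog (machines C) :=
  (move input aux).seq <| (duplicate _).seq <| (readBlocks _).seq <|
    (ite rest (· == some false) ((pop rest).seq ((push word false).seq (simulate C is)))
      skip).seq <|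
    ite rest (· == some false) ((reset _).seq (push input true)) ((reset _).seq (clear input))

theorem does_diagProg {is : List ι} {B T : ℕ} {x : List Bool}
    (hT : ∀ i, ∀ m ≤ 2 * x.length, (C i).time.eval m ≤ T)
    (hB : ∀ i z y, z.length ≤ 2 * x.length → γ i z = some y → y.length ≤ B)
    (hn : x.length + 1 ≤ B) :
    (diagProg C is).Does (mem x [] [] [] [] [] [] [])
      (mem (encodeOutput (diag (nthFun γ is) x)) [] [] [] [] [] [] [])
      (x.length * (100 * (x.length + B + T + is.length + 1) + 3) +
        100 * (x.length + B + T + is.length + 1)) := by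
  have h1 := does_move (tm := machines C) (a := input) (b := aux) (by decide)
    (mem x [] [] [] [] [] [] [])
  simp only [update_mem_input, mem_input, update_mem_aux, mem_aux, List.append_nil] at h1
  have h2 := does_duplicate (tm := machines C) [] x.reverse [] [] [] [] [] []
  simp only [List.reverse_reverse, List.append_nil, List.length_reverse] at h2
  obtain ⟨v, w, r, h3, b1, b2, b3, h⟩ := does_readBlocks (tm := machines C) x x [] []
  -- Whatever the outcome of the simulation, the final test produces the right output.
  have key : ∀ v' r' j', v'.length ≤ x.length + 1 → r'.length ≤ B → j'.length ≤ x.length →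
      (v'.head? = some false ↔ DiagDom (nthFun γ is) x) → ∀ w', w'.length ≤ x.length →
      (ite rest (· == some false) ((reset _).seq (push input true))
        ((reset _).seq (clear input)) : Prog (machines C)).Does
        (mem x [] v' w' r' [] j' [])
        (mem (encodeOutput (diag (nthFun γ is) x)) [] [] [] [] [] [] [])
        (8 * x.length + 2 * B + 20) := by
    intro v' r' j' c1 c2 c3 hd w' c4
    have g1 := does_reset (tm := machines C) x [] v' w' r' [] j' []
    by_cases hx : DiagDom (nthFun γ is) x
    · have hx' := hd.2 hx
      have g2 := does_push (tm := machines C) input true (mem x [] [] [] [] [] [] [])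
      simp only [update_mem_input, mem_input] at g2
      rw [diag, if_pos hx]
      exact (Does.ite_true (by simp [hx']) (g1.seq g2)).mono (by simp; omega)
    · have hx' := fun h => hx (hd.1 h)
      have g2 := does_clear (tm := machines C) input (mem x [] [] [] [] [] [] [])
      simp only [update_mem_input, mem_input] at g2
      rw [diag, if_neg hx]
      exact (Does.ite_false (by simpa using hx') (g1.seq g2)).mono (by simp; omega)
  simp only [List.length_nil, zero_add] at b2 b3
  rcases h with ⟨hp, rfl⟩ | ⟨v, rfl, hp⟩
  · have h4 := key [] r [] (by simp) (by omega) (by simp) (by simp [DiagDom, hp]) w b2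
    exact (h1.seq (h2.seq (h3.seq ((Does.ite_false rfl (does_skip _)).seq h4)))).mono (by omega)
  · have h4 := does_pop (tm := machines C) rest (mem x [] (false :: v) w r [] [] [])
    have h5 := does_push (tm := machines C) word false (mem x [] v w r [] [] [])
    simp only [update_mem_rest, mem_rest, List.tail_cons, update_mem_word, mem_word] at h4 h5
    rw [List.length_cons] at b1
    obtain ⟨v', r', j', h6, c1, c2, c3, h7⟩ := does_simulate (is := is) (j := 0) (x := x) (v := v)
      (w := w) (r := false :: r) hT hB (by omega) (by omega) (by simp; omega)
    have h8 := key v' r' j' c1 c2 c3 (by simp [h7, DiagDom, hp]) [] (by simp)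
    refine (h1.seq (h2.seq (h3.seq ((Does.ite_true rfl (h4.seq (h5.seq h6))).seq h8)))).mono ?_
    have := Nat.mul_le_mul_right (100 * (x.length + B + T + is.length + 1) + 3) b2
    omega

end Simulation

end Prog

theorem diag_isPolyTime {ι : Type} [Fintype ι] {γ : ι → PartialWordFun} (hγ : ∀ i, γ i ∈ fP)
    (is : List ι) : (diag (nthFun γ is)).IsPolyTime := by
  classical
  choose p q hpq using fun i => (hγ i).1
  have C : ∀ i, TM2ComputableInPolyTime (fun x : List Bool => x) encodeOutput (γ i) :=
    fun i => Classical.choice (hγ i).2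
  let B : Polynomial ℕ := ∑ i, (p i).comp (2 * Polynomial.X) + (Polynomial.X + 1)
  let T : Polynomial ℕ := ∑ i, (C i).time.comp (2 * Polynomial.X)
  let Q : Polynomial ℕ := 100 * (Polynomial.X + B + T + Polynomial.C is.length + 1)
  have hsum : ∀ (P : ι → Polynomial ℕ) (i : ι) (m n : ℕ), m ≤ 2 * n →
      (P i).eval m ≤ (∑ i, (P i).comp (2 * Polynomial.X)).eval n := by
    intro P i m n hm
    rw [Polynomial.eval_finsetSum]
    refine le_trans ?_ (Finset.single_le_sum (f := fun i => ((P i).comp (2 * Polynomial.X)).eval n)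
      (fun _ _ => Nat.zero_le _) (Finset.mem_univ i))
    simpa using eval_le_eval (P i) hm
  refine isPolyTime_of_does (Prog.diagProg C is) (Polynomial.X * (Q + 3) + Q) fun x => ?_
  have h := Prog.does_diagProg (C := C) (is := is) (x := x) (B := B.eval x.length)
    (T := T.eval x.length) (fun i m hm => hsum (fun i => (C i).time) i m _ hm)
    (fun i z y hz hy => ?_) ?_
  · simpa [Q] using h
  · refine ((hpq i z y hy).1.trans (hsum p i _ _ hz)).trans ?_
    simp [B]
  · simp [B]

theorem diag_mem_RM2P {ι : Type} [Fintype ι] {γ : ι → PartialWordFun} (hγ : ∀ i, γ i ∈ fP)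
    (is : List ι) : diag (nthFun γ is) ∈ RM2P :=
  ⟨⟨diag_isPolyBalanced _, diag_isPolyTime hγ is⟩, diag_isRightIdealMorphism _⟩

end PartialWordFun

open PartialWordFun in
/-- `RM₂ᴾ` is a monoid under composition, and this monoid is not finitely generated. -/
theorem theorem3p1 :
    ∃ M : Submonoid PartialWordFun,
      (M : Set PartialWordFun) = PartialWordFun.RM2P ∧ ¬ Monoid.FG M := by
  refine ⟨monoidRM2P, rfl, fun hfg => ?_⟩
  obtain ⟨S, hS⟩ := (Monoid.fg_iff_submonoid_fg _).1 hfg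
  have hmem : ∀ s : S, (s : PartialWordFun) ∈ RM2P := fun s => by
    have : (s : PartialWordFun) ∈ monoidRM2P := hS ▸ Submonoid.subset_closure s.2
    exact this
  let g := nthFun (fun s : S => (s : PartialWordFun)) Finset.univ.toList
  have hg : ∀ j, (g j).IsRightIdealMorphism := by
    intro j x y hxy w
    obtain ⟨s, hs, h⟩ := Option.bind_eq_some_iff.1 hxy
    exact Option.bind_eq_some_iff.2 ⟨s, hs, (hmem s).2 x y h w⟩
  have hle : (monoidRM2P : Submonoid PartialWordFun) ≤ Submonoid.closure (Set.range g) := by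
    rw [← hS]
    refine Submonoid.closure_mono fun f hf => ?_
    obtain ⟨j, hj⟩ := List.mem_iff_getElem?.1 (Finset.mem_toList.2 (Finset.mem_univ (⟨f, hf⟩ : S)))
    refine ⟨j, funext fun x => ?_⟩
    change (Finset.univ.toList[j]?).bind _ = _
    rw [hj]
    rfl
  exact diag_notMem_closure hg (hle (diag_mem_RM2P (fun s => (hmem s).1) _))
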